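/- **Setting.** A (naturally) labelled causal set with $n$ elements is a strict partial order $\prec$ on $\{0,\dots,n-1\}$ such that $i\prec j$ implies $i<j$; an infinite one is defined in the same way on $\mathbb N$. For a labelled causal set $c$, $c(k)$ denotes the causal set formed by its first $k$ elements. A stem of $C$ is a subset that contains the past of each of its elements. A growth dynamics assigns to each finite labelled causal set $C$ a probability distribution on its transitions, one for each stem $A$ of $C$ (the ancestor set of the new element); write $P(C\to A)$ for the transition probabilities. The transition is *timid* if $A=C$ and *gregarious* if $A=\emptyset$. $\mathrm{Prob}(C)$ is the product of the transition probabilities along the growth of $C$; an infinite labelled $c$ is *admitted* if $\mathrm{Prob}(c(k))\neq0$ for all $k$. *General covariance* (GC): $\mathrm{Prob}(C)=\mathrm{Prob}(C')$ whenever $C\cong C'$. *Product Bell Causality* (PBC): $\alpha\tilde\beta=\tilde\alpha\beta$ for any two transitions from a causal set $C$ with probabilities $\alpha,\beta$, where $S$ is the set of their common spectators (the elements of $C$ that are in neither ancestor set) and $\tilde\alpha,\tilde\beta$ are the probabilities of the corresponding transitions from $C\setminus S$ (labelled in the induced order). $c$ has a *break at rank $m$ with past $a$* if $c(m)=a$ and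 all other elements of $c$ lie above all elements of $a$. The stack $a\triangleleft b$ is $b$ placed above all of $a$; the $a$-relative $k$-antichain is $a\triangleleft(k\text{-antichain})$. Let $q_n$ be the probability of the transition from the $n$-antichain to the $(n+1)$-antichain, and let $q_{(a)k}$ be the probability of the transition from the $a$-relative $k$-antichain to the $a$-relative $(k+1)$-antichain (for $k=0$, the timid transition from $a$). Let $n(a)\in\mathbb N\cup\{\infty\}$ be the least $k$ with $q_{(a)k}=0$ ($\infty$ if there is none), and $$t_{(a)i}=\sum_{k=0}^i(-1)^{i-k}\binom ik\frac1{q_{(a)k}},\qquad \lambda_{(a)}(\varpi,p)=\sum_{i=p}^{\varpi}\binom{\varpi-p}{\varpi-i}t_{(a)i}.$$ **Theorem.** Suppose that a growth dynamics satisfies GC and PBC. Then: 1. (Gregarious transitions.) If $C$ has $n$ elements, $\mathrm{Prob}(C)\ne0$ and $q_i\neq0$ for $i<n$, then the gregarious transition from $C$ has probability $q_n$. More generally, if $C$ has $|a|+n$ elements and a break with past $a$, $\mathrm{Prob}(C)\neq0$ and $q_{(a)i}\ne0$ for $i<n$, then the $a$-relative gregarious transition from $C$ (ancestor set $a$) has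 probability $q_{(a)n}$. 2. (Era boundaries.) If $q_l\ne0$ for $l<n$ and $q_n=0$, then for each $n$-element $C$ with $\mathrm{Prob}(C)\neq0$ the timid transition is the only non-vanishing transition from $C$. More generally, if $n\ge1$, $q_{(a)l}\neq0$ for $l<n$ and $q_{(a)n}=0$, then for each $C$ with $|a|+n$ elements, a break with past $a$ and $\mathrm{Prob}(C)\ne0$, the timid transition is the only non-vanishing transition from $C$. 3. (Breaks.) If $q_l\ne0$ for $l<n$ and $q_n=0$, then every admitted infinite causal set has a break at rank $n$. More generally, if $n\ge 1$, $q_{(a)l}\neq0$ for $l<n$ and $q_{(a)n}=0$, then every admitted infinite causal set with a break at rank $|a|$ with past $a$ also has a break at rank $|a|+n$. 4. (Extended percolation.) The dynamics is the extended percolation with era lengths $n(a)$ and coupling constants $t_{(a)i}$, $i<n(a)$. That is, define the admitted stacks recursively: $\emptyset$ is one, and if $a$ is one and $n(a)<\infty$, then so is every $c$ with $|a|+n(a)$ elements, a break with past $a$ and $\mathrm{Prob}(c)\ne0$. Then for each admitted stack $a$: $n(a)\geq1$, $t_{(a)0}=1$, $t_{(a)i}\ge0$ for $i<n(a)$; $n(a)$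 and the $t_{(a)i}$ with $i<n(a)$ depend only on the isomorphism class of the admitted stack $a$; and for each $c=a\triangleleft b$ with $|b|=k<n(a)$ and $\mathrm{Prob}(c)\ne0$, the transition from $c$ with ancestor set $A$ has probability $0$ if $A\not\supseteq a$, and otherwise $$\frac{\lambda_{(a)}(\varpi,p)}{\lambda_{(a)}(k,0)},$$ where $\varpi=|A\cap b|$ and $p$ is the number of maximal elements of $A$ that lie in $b$. -/

import Mathlib

/-- A naturally labelled causal set with `n` elements: a strict partial order on the labels
`0, 1, ..., n - 1` such that `i ≺ j` implies `i < j`.  The relation is written on `ℕ` and is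
supported on the labels below `n`, so each labelled causal set has exactly one representation. -/
@[ext]
structure LCauset (n : ℕ) where
  /-- `rel i j` says that `i` precedes `j`. -/
  rel : ℕ → ℕ → Prop
  lt_of_rel : ∀ {i j}, rel i j → i < j
  lt_card : ∀ {i j}, rel i j → j < n
  trans : ∀ {i j k}, rel i j → rel j k → rel i k

/-- A completed (infinite) labelled causal set, with a natural labelling by `ℕ`
(in particular it is past finite). -/
@[ext]
structure InfCauset where
  rel : ℕ → ℕ → Prop
  lt_of_rel : ∀ {i j}, rel i j → i < j
  trans : ∀ {i j k}, rel i j → rel j k → rel i k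

/-- The causal set formed by the first `n` elements of an infinite labelled causal set. -/
def InfCauset.initial (c : InfCauset) (n : ℕ) : LCauset n where
  rel i j := c.rel i j ∧ j < n
  lt_of_rel h := c.lt_of_rel h.1
  lt_card h := h.2
  trans h h' := ⟨c.trans h.1 h'.1, h'.2⟩

/-- `c` has a break with past `a`: the first `m` elements of `c` form `a`, and
every other element of `c` is above every element of `a`. -/
def InfCauset.HasBreak (c : InfCauset) {m : ℕ} (a : LCauset m) : Prop :=
  c.initial m = a ∧ ∀ i j, i < m → m ≤ j → c.rel i j

namespace LCauset

variable {n : ℕ}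

/-- The `n`-antichain: `n` unrelated elements. -/
def antichain (n : ℕ) : LCauset n where
  rel _ _ := False
  lt_of_rel h := h.elim
  lt_card h := h.elim
  trans h _ := h.elim

/-- The causal set formed by the first `k` elements of `C` (for `k ≤ n`). -/
def initial (C : LCauset n) (k : ℕ) : LCauset k where
  rel i j := C.rel i j ∧ j < k
  lt_of_rel h := C.lt_of_rel h.1
  lt_card h := h.2
  trans h h' := ⟨C.trans h.1 h'.1, h'.2⟩

open Classical in
/-- The ancestors of the element `j`. -/
noncomputable def ancestors (C : LCauset n) (j : ℕ) : Finset ℕ :=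
  (Finset.range j).filter (fun i => C.rel i j)

/-- `A` is a stem of `C`: a set of elements that contains its own past. -/
def IsStem (C : LCauset n) (A : Finset ℕ) : Prop :=
  A ⊆ Finset.range n ∧ ∀ i j, C.rel i j → j ∈ A → i ∈ A

open Classical in
/-- All stems of `C`.  They are the possible ancestor sets of a newly born element, so they
index the transitions from `C`. -/
noncomputable def stems (C : LCauset n) : Finset (Finset ℕ) :=
  (Finset.range n).powerset.filter (fun A => C.IsStem A)

/-- The spectators of the transition from `C` with ancestor set `A`: the elements of `C` that
are not ancestors of the new element. -/
def spectators (_C : LCauset n) (A : Finset ℕ) : Finset ℕ :=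
  Finset.range n \ A

/-- The sub-causal-set of `C` on a set `K` of its elements; the elements of `K` are relabelled
`0, 1, ..., |K| - 1` in increasing order. -/
noncomputable def restrict (C : LCauset n) (K : Finset ℕ) : LCauset K.card where
  rel i j := i < j ∧ j < K.card ∧ C.rel (Nat.nth (· ∈ K) i) (Nat.nth (· ∈ K) j)
  lt_of_rel h := h.1
  lt_card h := h.2.1
  trans h h' := ⟨h.1.trans h'.1, h'.2.1, C.trans h.2.2 h'.2.2⟩

/-- Isomorphism of (the unlabelled causal sets underlying) two labelled causal sets. -/
def Iso (C C' : LCauset n) : Prop :=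
  ∃ σ : Equiv.Perm (Fin n), ∀ i j : Fin n, C.rel i j ↔ C'.rel (σ i) (σ j)

/-- The stack `a ◁ b`: every element of `b` is put above every element of `a`. -/
def stack {m k : ℕ} (a : LCauset m) (b : LCauset k) : LCauset (m + k) where
  rel i j := a.rel i j ∨ (i < m ∧ m ≤ j ∧ j < m + k) ∨
    (m ≤ i ∧ m ≤ j ∧ b.rel (i - m) (j - m))
  lt_of_rel := by
    rintro i j (h | ⟨h, h', -⟩ | ⟨h, h', h''⟩)
    · exact a.lt_of_rel h
    · omega
    · have := b.lt_of_rel h''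
      omega
  lt_card := by
    rintro i j (h | ⟨-, -, h⟩ | ⟨h, h', h''⟩)
    · have := a.lt_card h
      omega
    · exact h
    · have := b.lt_card h''
      omega
  trans := by
    rintro i j l (h | ⟨h1, h2, h3⟩ | ⟨h1, h2, h3⟩) (h' | ⟨h1', h2', h3'⟩ | ⟨h1', h2', h3'⟩)
    · exact Or.inl (a.trans h h')
    · have := a.lt_of_rel h
      exact Or.inr (Or.inl ⟨by omega, h2', h3'⟩)
    · have := a.lt_card h
      omega
    · have := a.lt_card h'
      have := a.lt_of_rel h'
      omega
    · omega
    · have := b.lt_card h3'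
      exact Or.inr (Or.inl ⟨h1, h2', by omega⟩)
    · have := a.lt_card h'
      have := a.lt_of_rel h'
      omega
    · omega
    · exact Or.inr (Or.inr ⟨h1, h2', b.trans h3 h3'⟩)

/-- `C` has a break with past `a`: the first `m` elements of `C` form `a`, and
every other element of `C` is above every element of `a`. -/
def HasBreak (C : LCauset n) {m : ℕ} (a : LCauset m) : Prop :=
  m ≤ n ∧ C.initial m = a ∧ ∀ i j, i < m → m ≤ j → j < n → C.rel i j

/-- For `C` with a break at rank `m` and a stem `A`: the number of elements of `A` that lie
above the break. -/
def numAncestorsAbove (_C : LCauset n) (m : ℕ) (A : Finset ℕ) : ℕ :=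
  (A.filter (fun i => m ≤ i)).card

open Classical in
/-- For `C` with a break at rank `m` and a stem `A`: the number of maximal elements of `A`
(the parents of the new element) that lie above the break. -/
noncomputable def numParentsAbove (C : LCauset n) (m : ℕ) (A : Finset ℕ) : ℕ :=
  (A.filter (fun i => m ≤ i ∧ ∀ j ∈ A, ¬ C.rel i j)).card

end LCauset

/-- A sequential growth dynamics of labelled causal sets: for each finite labelled causal set `C`
a probability distribution on the transitions from `C`.  The number `prob C A` is the
probability that the next element is born with ancestor set `A`; it is meaningful when `A` is a
stem of `C`. -/
structure Growth where
  prob : {n : ℕ} → LCauset n → Finset ℕ → ℝ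
  prob_nonneg : ∀ {n : ℕ} (C : LCauset n), ∀ A ∈ C.stems, 0 ≤ prob C A
  sum_prob : ∀ {n : ℕ} (C : LCauset n), ∑ A ∈ C.stems, prob C A = 1

namespace Growth

/-- The probability that the first `n` stages produce the labelled causal set `C`. -/
noncomputable def Prob (P : Growth) {n : ℕ} (C : LCauset n) : ℝ :=
  ∏ k ∈ Finset.range n, P.prob (C.initial k) (C.ancestors k)

/-- General covariance: the probability of growing a causal set does not depend on the
labelling, that is, on the order in which its elements are born. -/
def GeneralCovariance (P : Growth) : Prop :=
  ∀ {n : ℕ} (C C' : LCauset n), C.Iso C' → P.Prob C = P.Prob C'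

open Classical in
/-- The probability of the transition from `C \ S` that corresponds to the transition from `C`
with ancestor set `A` (where no element of `S` lies in `A`). -/
noncomputable def probWithout (P : Growth) {n : ℕ} (C : LCauset n) (S A : Finset ℕ) : ℝ :=
  P.prob (C.restrict (Finset.range n \ S))
    ((Finset.range (Finset.range n \ S).card).filter
      (fun i => Nat.nth (· ∈ Finset.range n \ S) i ∈ A))

/-- Product Bell Causality `α β̃ = α̃ β`: here `α`, `β` are the probabilities of two transitions
from `C`, with ancestor sets `A` and `B`, and `α̃`, `β̃` those of the corresponding transitions
from `C \ S`, where `S` consists of all common spectators of the two transitions. -/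
def ProductBellCausality (P : Growth) : Prop :=
  ∀ {n : ℕ} (C : LCauset n), ∀ A ∈ C.stems, ∀ B ∈ C.stems,
    P.prob C A * P.probWithout C (C.spectators A ∩ C.spectators B) B =
      P.probWithout C (C.spectators A ∩ C.spectators B) A * P.prob C B

/-- `q_n`: the probability of the transition from the `n`-antichain to the `(n+1)`-antichain. -/
noncomputable def q (P : Growth) (n : ℕ) : ℝ :=
  P.prob (LCauset.antichain n) ∅

/-- `q_{(a) k}`: the probability of the transition from the `a`-relative `k`-antichain to the
`a`-relative `(k+1)`-antichain; for `k = 0` it is the timid transition from `a`. -/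
noncomputable def qRel (P : Growth) {m : ℕ} (a : LCauset m) (k : ℕ) : ℝ :=
  P.prob (a.stack (LCauset.antichain k)) (Finset.range m)

/-- An infinite labelled causal set is admitted if every finite stage of its growth has
non-zero probability. -/
def Admits (P : Growth) (c : InfCauset) : Prop :=
  ∀ n, P.Prob (c.initial n) ≠ 0

/-- The number `n(a)`: the first `k` with `q_{(a) k} = 0`, and `∞` if there is none. -/
noncomputable def eraLength (P : Growth) (m : ℕ) (a : LCauset m) : ℕ∞ :=
  sInf {x : ℕ∞ | ∃ k : ℕ, x = k ∧ P.qRel a k = 0}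

/-- The coupling constants relative to `a`:
`t_{(a) i} = ∑_{k ≤ i} (-1)^(i-k) (i choose k) / q_{(a) k}`. -/
noncomputable def coupling (P : Growth) (m : ℕ) (a : LCauset m) (i : ℕ) : ℝ :=
  ∑ k ∈ Finset.range (i + 1), (-1 : ℝ) ^ (i - k) * (i.choose k : ℝ) * (P.qRel a k)⁻¹

end Growth

/-- `λ(ϖ, m) = ∑_{i = m}^{ϖ} (ϖ - m choose ϖ - i) t_i` for `m ≤ ϖ`. -/
noncomputable def gpLambda (t : ℕ → ℝ) (w m : ℕ) : ℝ :=
  ∑ i ∈ Finset.Icc m w, ((w - m).choose (w - i) : ℝ) * t i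

namespace Growth

/-- The finite stacks of complete eras that occur with non-zero probability, if `len m a` is the
number of elements born in the era that follows the stack `a`. -/
inductive AdmittedStack (P : Growth) (len : (m : ℕ) → LCauset m → ℕ∞) :
    {m : ℕ} → LCauset m → Prop
  | empty : AdmittedStack P len (LCauset.antichain 0)
  | next {m k : ℕ} {a : LCauset m} {c : LCauset (m + k)} :
      AdmittedStack P len a → len m a = (k : ℕ∞) → c.HasBreak a → P.Prob c ≠ 0 →
      AdmittedStack P len c

/-- `P` is the extended percolation with era lengths `len` and coupling constants `t`.
After each admitted stack `a` of complete eras comes an era that lasts for `n(a) = len m a` stages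
(`1 ≤ n(a) ≤ ∞`), with coupling constants `t_0 = 1, t_1, ...` (`t_i` for `i < n(a)`) that are
non-negative.  Both depend only on the unlabelled causal set `a`.  During this era all new elements
are born above all of `a`, and the part above `a` grows by generalised percolation:
from `c = a ◁ b` with `b` of `k < n(a)` elements, a new element with ancestor set `A ⊇ a` is born with
probability `λ(ϖ, p) / λ(k, 0)`, where the new element has `ϖ` ancestors and `p` parents in `b`. -/
structure IsExtendedPercolationWith (P : Growth) (len : (m : ℕ) → LCauset m → ℕ∞)
    (t : (m : ℕ) → LCauset m → ℕ → ℝ) : Prop where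
  one_le_len : ∀ {m : ℕ} (a : LCauset m), P.AdmittedStack len a → 1 ≤ len m a
  coupling_zero : ∀ {m : ℕ} (a : LCauset m), P.AdmittedStack len a → t m a 0 = 1
  coupling_nonneg : ∀ {m : ℕ} (a : LCauset m), P.AdmittedStack len a →
    ∀ i : ℕ, (i : ℕ∞) < len m a → 0 ≤ t m a i
  len_iso : ∀ {m : ℕ} (a a' : LCauset m), P.AdmittedStack len a → P.AdmittedStack len a' →
    a.Iso a' → len m a = len m a'
  coupling_iso : ∀ {m : ℕ} (a a' : LCauset m), P.AdmittedStack len a → P.AdmittedStack len a' →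
    a.Iso a' → ∀ i : ℕ, (i : ℕ∞) < len m a → t m a i = t m a' i
  prob_of_superset : ∀ {m k : ℕ} (a : LCauset m), P.AdmittedStack len a →
    (k : ℕ∞) < len m a → ∀ c : LCauset (m + k), c.HasBreak a → P.Prob c ≠ 0 →
    ∀ A ∈ c.stems, Finset.range m ⊆ A →
      P.prob c A = gpLambda (t m a) (c.numAncestorsAbove m A) (c.numParentsAbove m A) /
        gpLambda (t m a) k 0
  prob_of_not_superset : ∀ {m k : ℕ} (a : LCauset m), P.AdmittedStack len a →
    (k : ℕ∞) < len m a → ∀ c : LCauset (m + k), c.HasBreak a → P.Prob c ≠ 0 →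
    ∀ A ∈ c.stems, ¬ Finset.range m ⊆ A → P.prob c A = 0

end Growth

/-! The engine is that relative gregarious probabilities depend only on the number of elements above
the break. Let `C` have a break with past `a` and `r` elements above it. Bell Causality compares a
birth with ancestor set `A ⊇ a` to the birth directly above `a`. Elements added directly above `a`
are common spectators of both, so they leave the reduced probabilities unchanged. Covariance lets
such elements be born before or after the last element of `C`. The two facts together remove the
elements of `C` above `a` one at a time, until only an `a`-relative antichain is left
(`Prob_addAbove_ne_zero_and_prob_eq_qRel`).

Bell Causality then expresses each transition through a timid one (`prob_mul_qRel`): P(C → A) ·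
q_(|A|-|a|) = P(timid from C|A) · q_(|C|-|a|), with q relative to `a`. If the last factor vanishes
and the earlier q's do not, only the timid transition survives. From then on Bell Causality forces
every birth above all of `C`, which is a break.

Inside an era the timid probability is fixed by normalisation, inductively in the size. The number
λ(ϖ, p) is the total weight, t_|S| for each S, of the sets S above the break that generate a given
stem. Summing over stems therefore sums over all such S, and binomial inversion gives 1/q
(`sum_gpLambda_stems`, `prob_timid_eq`). -/

namespace Nat

/-! ### Increasing enumeration of a finite set -/

lemma nth_mem_finset {K : Finset ℕ} {i : ℕ} (hi : i < K.card) : Nat.nth (· ∈ K) i ∈ K := by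
  have hf : (Set.ofPred (· ∈ K)).Finite := K.finite_toSet
  have : hf.toFinset = K := by ext; simp
  exact Nat.nth_mem_of_lt_card hf (by rwa [this])

lemma nth_finset_lt_iff {K : Finset ℕ} {i j : ℕ} (hi : i < K.card) (hj : j < K.card) :
    Nat.nth (· ∈ K) i < Nat.nth (· ∈ K) j ↔ i < j := by
  have hf : (Set.ofPred (· ∈ K)).Finite := K.finite_toSet
  have hK : hf.toFinset = K := by ext; simp
  exact (Nat.nth_strictMonoOn hf).lt_iff_lt (by simpa [hK] using hi) (by simpa [hK] using hj)

lemma nth_finset_inj {K : Finset ℕ} {i j : ℕ} (hi : i < K.card) (hj : j < K.card)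
    (h : Nat.nth (· ∈ K) i = Nat.nth (· ∈ K) j) : i = j := by
  have h1 := nth_finset_lt_iff hi hj
  have h2 := nth_finset_lt_iff hj hi
  omega

lemma exists_nth_finset_eq {K : Finset ℕ} {x : ℕ} (hx : x ∈ K) :
    ∃ i < K.card, Nat.nth (· ∈ K) i = x := by
  have hf : (Set.ofPred (· ∈ K)).Finite := K.finite_toSet
  have hK : hf.toFinset = K := by ext; simp
  obtain ⟨i, hi, h⟩ := Nat.exists_lt_card_finite_nth_eq hf (p := (· ∈ K)) hx
  exact ⟨i, by rwa [hK] at hi, h⟩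

lemma nth_finset_of_range_subset {K : Finset ℕ} {m i : ℕ} (h : Finset.range m ⊆ K) (hi : i < m) :
    Nat.nth (· ∈ K) i = i := by
  have hc : Nat.count (· ∈ K) i = i := by
    rw [Nat.count_iff_forall]
    intro j hj
    exact h (Finset.mem_range.2 (hj.trans hi))
  have := Nat.nth_count (p := (· ∈ K)) (h (Finset.mem_range.2 hi))
  rwa [hc] at this

lemma le_nth_finset {K : Finset ℕ} {i : ℕ} (hi : i < K.card) : i ≤ Nat.nth (· ∈ K) i := by
  apply Nat.le_nth
  intro hf
  have hK : hf.toFinset = K := by ext; simp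
  rwa [hK]

end Nat

/-! ### Growth, breaks and restriction of causal sets -/

namespace LCauset

variable {n : ℕ}

lemma ext_rel {C C' : LCauset n} (h : ∀ i j, C.rel i j ↔ C'.rel i j) : C = C' :=
  LCauset.ext (by funext i j; exact propext (h i j))

lemma mem_ancestors {C : LCauset n} {i j : ℕ} : i ∈ C.ancestors j ↔ C.rel i j := by
  simp only [ancestors, Finset.mem_filter, Finset.mem_range, and_iff_right_iff_imp]
  exact C.lt_of_rel

lemma mem_stems {C : LCauset n} {A : Finset ℕ} : A ∈ C.stems ↔ C.IsStem A := by
  simp only [stems, Finset.mem_filter, Finset.mem_powerset, and_iff_right_iff_imp]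
  exact fun h => h.1

lemma isStem_range (C : LCauset n) {m : ℕ} (hm : m ≤ n) : C.IsStem (Finset.range m) := by
  refine ⟨Finset.range_subset_range.2 hm, fun i j h hj => ?_⟩
  have := C.lt_of_rel h
  simp only [Finset.mem_range] at *
  omega

lemma initial_initial (C : LCauset n) {k l : ℕ} (h : k ≤ l) :
    (C.initial l).initial k = C.initial k := by
  refine ext_rel fun i j => ?_
  simp only [initial]
  exact ⟨fun h => ⟨h.1.1, h.2⟩, fun h' => ⟨⟨h'.1, by omega⟩, h'.2⟩⟩

lemma initial_self (C : LCauset n) : C.initial n = C :=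
  ext_rel fun _ _ => ⟨fun h => h.1, fun h => ⟨h, C.lt_card h⟩⟩

lemma ancestors_initial (C : LCauset n) {k l : ℕ} (h : k < l) :
    (C.initial l).ancestors k = C.ancestors k := by
  ext i
  simp only [mem_ancestors, initial]
  exact ⟨fun h => h.1, fun h' => ⟨h', h⟩⟩

lemma isStem_ancestors (C : LCauset n) {k : ℕ} : (C.initial k).IsStem (C.ancestors k) := by
  refine ⟨fun i hi => ?_, fun i j h hj => ?_⟩
  · rw [mem_ancestors] at hi
    exact Finset.mem_range.2 (C.lt_of_rel hi)
  · rw [mem_ancestors] at *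
    exact C.trans h.1 hj

/-- The causal set obtained from `C` by the birth of a new element with ancestor set `A`. -/
def grow (C : LCauset n) (A : Finset ℕ) (hA : C.IsStem A) : LCauset (n + 1) where
  rel i j := C.rel i j ∨ (i ∈ A ∧ j = n)
  lt_of_rel := by
    rintro i j (h | ⟨h, rfl⟩)
    · exact C.lt_of_rel h
    · exact Finset.mem_range.1 (hA.1 h)
  lt_card := by
    rintro i j (h | ⟨h, rfl⟩)
    · exact (C.lt_card h).trans (Nat.lt_succ_self n)
    · exact Nat.lt_succ_self _
  trans := by
    rintro i j k (h | ⟨h, rfl⟩) (h' | ⟨h', rfl⟩)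
    · exact Or.inl (C.trans h h')
    · exact Or.inr ⟨hA.2 _ _ h h', rfl⟩
    · have := C.lt_of_rel h'
      have := C.lt_card h'
      omega
    · exact absurd (Finset.mem_range.1 (hA.1 h')) (lt_irrefl _)

/-- The causal set obtained from `C` by adding `j` mutually unrelated elements, each of whose
ancestors are the first `m` elements of `C`. -/
def addAbove (C : LCauset n) (m j : ℕ) (hm : m ≤ n) : LCauset (n + j) where
  rel x y := C.rel x y ∨ (x < m ∧ n ≤ y ∧ y < n + j)
  lt_of_rel := by
    rintro x y (h | h)
    · exact C.lt_of_rel h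
    · omega
  lt_card := by
    rintro x y (h | h)
    · have := C.lt_card h
      omega
    · omega
  trans := by
    rintro x y z (h | h) (h' | h')
    · exact Or.inl (C.trans h h')
    · have := C.lt_of_rel h
      exact Or.inr (by omega)
    · have := C.lt_card h'
      have := C.lt_of_rel h'
      omega
    · exact Or.inr (by omega)

lemma grow_initial_ancestors (C : LCauset (n + 1)) :
    (C.initial n).grow (C.ancestors n) C.isStem_ancestors = C := by
  refine ext_rel fun i j => ?_
  simp only [grow, initial, mem_ancestors]
  constructor
  · rintro (h | ⟨h, rfl⟩)
    · exact h.1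
    · exact h
  · intro h
    have := C.lt_card h
    by_cases hj : j = n
    · exact Or.inr ⟨hj ▸ h, hj⟩
    · exact Or.inl ⟨h, by omega⟩

lemma initial_grow (C : LCauset n) {A : Finset ℕ} (hA : C.IsStem A) :
    (C.grow A hA).initial n = C := by
  refine ext_rel fun i j => ?_
  simp only [grow, initial]
  constructor
  · rintro ⟨h | ⟨_, rfl⟩, h'⟩
    · exact h
    · omega
  · exact fun h => ⟨Or.inl h, C.lt_card h⟩

lemma ancestors_grow (C : LCauset n) {A : Finset ℕ} (hA : C.IsStem A) :
    (C.grow A hA).ancestors n = A := by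
  ext i
  simp only [mem_ancestors, grow]
  constructor
  · rintro (h | h)
    · exact absurd (C.lt_card h) (lt_irrefl _)
    · exact h.1
  · exact fun h => Or.inr ⟨h, trivial⟩

lemma addAbove_zero (C : LCauset n) {m : ℕ} (hm : m ≤ n) : C.addAbove m 0 hm = C := by
  refine ext_rel fun i j => ?_
  simp only [addAbove]
  refine ⟨?_, Or.inl⟩
  rintro (h | h)
  · exact h
  · omega

lemma stack_antichain {m : ℕ} (a : LCauset m) (k : ℕ) :
    a.stack (antichain k) = a.addAbove m k le_rfl := by
  refine ext_rel fun i j => ?_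
  simp [addAbove, stack, antichain]

lemma addAbove_succ (C : LCauset n) {m : ℕ} (j : ℕ) (hm : m ≤ n) :
    C.addAbove m (j + 1) hm =
      (C.addAbove m j hm).grow (Finset.range m) (isStem_range _ (by omega)) := by
  refine ext_rel fun x y => ?_
  simp only [addAbove, grow, Finset.mem_range]
  by_cases h : C.rel x y
  · simp [h]
  · simp only [h, false_or]
    omega

lemma initial_addAbove (C : LCauset n) {m j : ℕ} (hm : m ≤ n) :
    (C.addAbove m j hm).initial n = C := by
  refine ext_rel fun x y => ?_
  simp only [addAbove, initial]
  refine ⟨?_, fun h => ⟨Or.inl h, C.lt_card h⟩⟩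
  rintro ⟨h | h, h'⟩
  · exact h
  · omega

lemma IsStem.addAbove {C : LCauset n} {m j : ℕ} {hm : m ≤ n} {A : Finset ℕ} (hA : C.IsStem A)
    (hmA : Finset.range m ⊆ A) : (C.addAbove m j hm).IsStem A := by
  refine ⟨hA.1.trans (Finset.range_subset_range.2 (by omega)), ?_⟩
  rintro x y (h | h) hy
  · exact hA.2 _ _ h hy
  · exact hmA (Finset.mem_range.2 h.1)

/-- A single element above the break already has all of `a` in its past, so a stem either contains
`a` or lies inside it. -/
lemma IsStem.subset_range_of_hasBreak {m : ℕ} {a : LCauset m} {C : LCauset n} {A : Finset ℕ}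
    (hC : C.HasBreak a) (hA : C.IsStem A) (h : ¬ Finset.range m ⊆ A) : A ⊆ Finset.range m := by
  intro j hj
  by_contra hjm
  rw [Finset.mem_range, not_lt] at hjm
  exact h fun i hi => hA.2 i j
    (hC.2.2 i j (Finset.mem_range.1 hi) hjm (Finset.mem_range.1 (hA.1 hj))) hj

lemma HasBreak.initial {m : ℕ} {a : LCauset m} {C : LCauset n} (hC : C.HasBreak a) {k : ℕ}
    (hmk : m ≤ k) (hk : k ≤ n) : (C.initial k).HasBreak a := by
  refine ⟨hmk, by rw [initial_initial _ hmk, hC.2.1], fun i j hi hj hjk => ⟨?_, hjk⟩⟩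
  exact hC.2.2 i j hi hj (by omega)

lemma hasBreak_self {m : ℕ} (a : LCauset m) : a.HasBreak a :=
  ⟨le_rfl, initial_self a, fun _ _ _ _ _ => by omega⟩

lemma HasBreak.addAbove {m : ℕ} {a : LCauset m} {C : LCauset n} (hC : C.HasBreak a) (j : ℕ) :
    (C.addAbove m j hC.1).HasBreak a := by
  refine ⟨hC.1.trans (Nat.le_add_right _ _), ?_, fun i l hi hl hl' => ?_⟩
  · rw [← initial_initial _ hC.1, initial_addAbove, hC.2.1]
  · by_cases h : l < n
    · exact Or.inl (hC.2.2 i l hi hl h)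
    · exact Or.inr (by omega)

lemma HasBreak.range_subset_ancestors {m : ℕ} {a : LCauset m} {C : LCauset n}
    (hC : C.HasBreak a) {k : ℕ} (hmk : m ≤ k) (hk : k < n) :
    Finset.range m ⊆ C.ancestors k := by
  intro i hi
  rw [mem_ancestors]
  exact hC.2.2 i k (Finset.mem_range.1 hi) hmk hk

open Classical in
/-- The labels in `C.restrict K` of those elements of `K` that lie in `A`. -/
noncomputable def relabel (K A : Finset ℕ) : Finset ℕ :=
  (Finset.range K.card).filter (fun i => Nat.nth (· ∈ K) i ∈ A)

lemma mem_relabel {K A : Finset ℕ} {i : ℕ} :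
    i ∈ relabel K A ↔ i < K.card ∧ Nat.nth (· ∈ K) i ∈ A := by
  simp [relabel]

lemma relabel_self (K : Finset ℕ) : relabel K K = Finset.range K.card := by
  ext i
  rw [mem_relabel, Finset.mem_range, and_iff_left_iff_imp]
  exact Nat.nth_mem_finset

lemma relabel_range {K : Finset ℕ} {m : ℕ} (h : Finset.range m ⊆ K) :
    relabel K (Finset.range m) = Finset.range m := by
  have hc : m ≤ K.card := by simpa using Finset.card_le_card h
  ext i
  rw [mem_relabel, Finset.mem_range, Finset.mem_range]
  constructor
  · rintro ⟨hi, h'⟩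
    exact (Nat.le_nth_finset hi).trans_lt h'
  · exact fun hi => ⟨by omega, by rwa [Nat.nth_finset_of_range_subset h hi]⟩

lemma relabel_of_subset_range {m : ℕ} {A : Finset ℕ} (hA : A ⊆ Finset.range m) :
    relabel (Finset.range m) A = A := by
  ext i
  rw [mem_relabel, Finset.card_range]
  constructor
  · rintro ⟨hi, h⟩
    rwa [Nat.nth_finset_of_range_subset subset_rfl hi] at h
  · intro h
    have hi := Finset.mem_range.1 (hA h)
    exact ⟨hi, by rwa [Nat.nth_finset_of_range_subset subset_rfl hi]⟩

/-- The two causal sets have the types `LCauset (Finset.range m).card` and `LCauset m`, so only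
their relations are compared; `prob_congr` transports this to probabilities. -/
lemma restrict_range_rel (C : LCauset n) (m : ℕ) :
    (C.restrict (Finset.range m)).rel = (C.initial m).rel := by
  funext i j
  apply propext
  simp only [restrict, initial, Finset.card_range]
  constructor
  · rintro ⟨h, h', h''⟩
    rw [Nat.nth_finset_of_range_subset subset_rfl h',
      Nat.nth_finset_of_range_subset subset_rfl (h.trans h')] at h''
    exact ⟨h'', h'⟩
  · rintro ⟨h, h'⟩
    have hij := C.lt_of_rel h
    refine ⟨hij, h', ?_⟩
    rwa [Nat.nth_finset_of_range_subset subset_rfl h',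
      Nat.nth_finset_of_range_subset subset_rfl (hij.trans h')]

lemma HasBreak.restrict {m : ℕ} {a : LCauset m} {C : LCauset n} (hC : C.HasBreak a)
    {K : Finset ℕ} (hmK : Finset.range m ⊆ K) (hK : K ⊆ Finset.range n) :
    (C.restrict K).HasBreak a := by
  have hc : m ≤ K.card := by simpa using Finset.card_le_card hmK
  refine ⟨hc, ?_, fun i j hi hj hjK => ⟨by omega, hjK, ?_⟩⟩
  · rw [← hC.2.1]
    refine ext_rel fun i j => ?_
    simp only [LCauset.initial, LCauset.restrict]
    constructor
    · rintro ⟨⟨h, h', h''⟩, hj⟩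
      rw [Nat.nth_finset_of_range_subset hmK hj,
        Nat.nth_finset_of_range_subset hmK (h.trans hj)] at h''
      exact ⟨h'', hj⟩
    · rintro ⟨h, hj⟩
      have hij := C.lt_of_rel h
      refine ⟨⟨hij, by omega, ?_⟩, hj⟩
      rwa [Nat.nth_finset_of_range_subset hmK hj,
        Nat.nth_finset_of_range_subset hmK (hij.trans hj)]
  · rw [Nat.nth_finset_of_range_subset hmK hi]
    exact hC.2.2 _ _ hi (hj.trans (Nat.le_nth_finset hjK))
      (Finset.mem_range.1 (hK (Nat.nth_mem_finset hjK)))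

/-- The added elements are outside `K`. This makes the reduced probabilities in Bell Causality
independent of `j`. -/
lemma restrict_addAbove (C : LCauset n) {m j : ℕ} (hm : m ≤ n) {K : Finset ℕ}
    (hK : K ⊆ Finset.range n) : (C.addAbove m j hm).restrict K = C.restrict K := by
  refine ext_rel fun x y => ?_
  simp only [restrict, addAbove]
  refine and_congr_right fun _ => and_congr_right fun hy => or_iff_left fun h => ?_
  have := Finset.mem_range.1 (hK (Nat.nth_mem_finset hy))
  omega

end LCauset

/-! ### Covariance and Bell Causality in usable form -/

namespace Growth

variable (P : Growth)

lemma Prob_eq_mul {n : ℕ} (C : LCauset (n + 1)) :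
    P.Prob C = P.Prob (C.initial n) * P.prob (C.initial n) (C.ancestors n) := by
  unfold Prob
  rw [Finset.prod_range_succ]
  congr 1
  refine Finset.prod_congr rfl fun k hk => ?_
  rw [Finset.mem_range] at hk
  rw [LCauset.initial_initial _ hk.le, LCauset.ancestors_initial _ hk]

lemma Prob_grow {n : ℕ} (C : LCauset n) {A : Finset ℕ} (hA : C.IsStem A) :
    P.Prob (C.grow A hA) = P.Prob C * P.prob C A := by
  rw [Prob_eq_mul, LCauset.initial_grow, LCauset.ancestors_grow]

lemma Prob_addAbove_succ {n : ℕ} (C : LCauset n) {m : ℕ} (hm : m ≤ n) (j : ℕ) :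
    P.Prob (C.addAbove m (j + 1) hm) =
      P.Prob (C.addAbove m j hm) * P.prob (C.addAbove m j hm) (Finset.range m) := by
  rw [LCauset.addAbove_succ, Prob_grow]

variable {P}

lemma Prob_initial_ne_zero {n : ℕ} {C : LCauset n} (h : P.Prob C ≠ 0) {k : ℕ} (hk : k ≤ n) :
    P.Prob (C.initial k) ≠ 0 := by
  unfold Prob at *
  rw [Finset.prod_ne_zero_iff] at *
  intro i hi
  rw [Finset.mem_range] at hi
  rw [LCauset.initial_initial _ hi.le, LCauset.ancestors_initial _ hi]
  exact h i (Finset.mem_range.2 (by omega))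

lemma prob_ancestors_ne_zero {n : ℕ} {C : LCauset n} (h : P.Prob C ≠ 0) {k : ℕ} (hk : k < n) :
    P.prob (C.initial k) (C.ancestors k) ≠ 0 := by
  unfold Prob at h
  rw [Finset.prod_ne_zero_iff] at h
  exact h k (Finset.mem_range.2 hk)

variable (P) in
lemma prob_congr {n n' : ℕ} (h : n = n') {C : LCauset n} {C' : LCauset n'} (hrel : C.rel = C'.rel)
    (A : Finset ℕ) : P.prob C A = P.prob C' A := by
  subst h
  rw [LCauset.ext hrel]

/-- An injective map of labels that preserves and reflects the order preserves the probability. -/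
lemma GeneralCovariance.Prob_congr (hGC : P.GeneralCovariance) {n n' : ℕ} (h : n = n')
    (C : LCauset n) (C' : LCauset n') (f : ℕ → ℕ) (hf : ∀ i < n, f i < n)
    (hinj : ∀ i < n, ∀ j < n, f i = f j → i = j)
    (hrel : ∀ i < n, ∀ j < n, (C.rel i j ↔ C'.rel (f i) (f j))) : P.Prob C = P.Prob C' := by
  subst h
  have hi : Function.Injective (fun i : Fin n => (⟨f i, hf i i.2⟩ : Fin n)) := by
    intro i j hij
    exact Fin.ext (hinj i i.2 j j.2 (Fin.mk.inj hij))
  exact hGC _ _ ⟨Equiv.ofBijective _ (Finite.injective_iff_bijective.1 hi),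
    fun i j => hrel i i.2 j j.2⟩

/-- A stem can be born before everything else: some natural labelling of `C` starts with `A`, and by
covariance it is as probable as `C`. The restriction is then an initial stage of a possible growth.
-/
lemma GeneralCovariance.Prob_restrict_ne_zero (hGC : P.GeneralCovariance) {n : ℕ} {C : LCauset n}
    (hC : P.Prob C ≠ 0) {A : Finset ℕ} (hA : C.IsStem A) : P.Prob (C.restrict A) ≠ 0 := by
  set B := Finset.range n \ A with hB
  have hcard : A.card + B.card = n := by
    rw [hB, Finset.card_sdiff_of_subset hA.1, Finset.card_range]
    have := Finset.card_le_card hA.1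
    rw [Finset.card_range] at this
    omega
  -- `f` lists `A` in increasing order and then its complement; `C'` is `C` pulled back along `f`.
  set f : ℕ → ℕ := fun i => if i < A.card then Nat.nth (· ∈ A) i
    else Nat.nth (· ∈ B) (i - A.card) with hf
  have f1 : ∀ i, i < A.card → f i = Nat.nth (· ∈ A) i := fun i hi => by simp [hf, hi]
  have f2 : ∀ i, ¬ i < A.card → f i = Nat.nth (· ∈ B) (i - A.card) := fun i hi => by
    simp [hf, hi]
  have m1 : ∀ i, i < A.card → f i ∈ A := fun i hi => by
    rw [f1 i hi]; exact Nat.nth_mem_finset hi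
  have m2 : ∀ i, i < n → ¬ i < A.card → f i ∈ B := fun i hi hi' => by
    rw [f2 i hi']; exact Nat.nth_mem_finset (by omega)
  let C' : LCauset n :=
    { rel := fun i j => i < n ∧ j < n ∧ C.rel (f i) (f j)
      lt_of_rel := by
        rintro i j ⟨hi, hj, h⟩
        have hlt := C.lt_of_rel h
        by_cases hi' : i < A.card
        · by_cases hj' : j < A.card
          · rw [f1 i hi', f1 j hj', Nat.nth_finset_lt_iff hi' hj'] at hlt
            exact hlt
          · omega
        · by_cases hj' : j < A.card
          -- The only order that could violate natural labelling, an element outside `A` below one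
          -- inside, is excluded because `A` is a stem.
          · have h1 := hA.2 _ _ h (m1 j hj')
            have h2 := m2 i hi hi'
            rw [hB, Finset.mem_sdiff] at h2
            exact absurd h1 h2.2
          · rw [f2 i hi', f2 j hj', Nat.nth_finset_lt_iff (by omega) (by omega)] at hlt
            omega
      lt_card := fun h => h.2.1
      trans := fun h h' => ⟨h.1, h'.2.1, C.trans h.2.2 h'.2.2⟩ }
  have hP : P.Prob C' = P.Prob C := by
    refine hGC.Prob_congr rfl C' C f (fun i hi => ?_) (fun i hi j hj hij => ?_)
      (fun i hi j hj => ⟨fun h => h.2.2, fun h => ⟨hi, hj, h⟩⟩)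
    · by_cases hi' : i < A.card
      · exact Finset.mem_range.1 (hA.1 (m1 i hi'))
      · exact Finset.mem_range.1 (Finset.sdiff_subset (m2 i hi hi'))
    · by_cases hi' : i < A.card <;> by_cases hj' : j < A.card
      · rw [f1 i hi', f1 j hj'] at hij
        exact Nat.nth_finset_inj hi' hj' hij
      · have h1 := m1 i hi'
        have h2 := m2 j hj hj'
        rw [← hij, hB, Finset.mem_sdiff] at h2
        exact absurd h1 h2.2
      · have h1 := m1 j hj'
        have h2 := m2 i hi hi'
        rw [hij, hB, Finset.mem_sdiff] at h2
        exact absurd h1 h2.2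
      · rw [f2 i hi', f2 j hj'] at hij
        have := Nat.nth_finset_inj (K := B) (by omega) (by omega) hij
        omega
  have hi : C'.initial A.card = C.restrict A := by
    refine LCauset.ext_rel fun i j => ?_
    constructor
    · rintro ⟨h, hj⟩
      have hij := C'.lt_of_rel h
      have := h.2.2
      rw [f1 i (hij.trans hj), f1 j hj] at this
      exact ⟨hij, hj, this⟩
    · rintro ⟨hij, hj, h⟩
      rw [← f1 i (hij.trans hj), ← f1 j hj] at h
      exact ⟨⟨by omega, by omega, h⟩, hj⟩
  rw [← hi]
  exact Prob_initial_ne_zero (hP ▸ hC) (by omega)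

/-- Product Bell Causality for two transitions of which one has the larger ancestor set. -/
lemma ProductBellCausality.of_subset (hPBC : P.ProductBellCausality) {n : ℕ} {C : LCauset n}
    {A B : Finset ℕ} (hA : C.IsStem A) (hB : C.IsStem B) (hBA : B ⊆ A) :
    P.prob C A * P.prob (C.restrict A) (LCauset.relabel A B) =
      P.prob (C.restrict A) (Finset.range A.card) * P.prob C B := by
  have hS : ∀ S, Finset.range n \ S = A → ∀ X,
      P.probWithout C S X = P.prob (C.restrict A) (LCauset.relabel A X) := by
    rintro S rfl X
    rfl
  -- As `B ⊆ A`, the common spectators are exactly the complement of `A`, so the reduced transition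
  -- for `A` is timid.
  have h : Finset.range n \ (C.spectators A ∩ C.spectators B) = A := by
    ext i
    have h1 := @hA.1 i
    have h2 := @hBA i
    simp only [LCauset.spectators, Finset.mem_sdiff, Finset.mem_inter] at *
    tauto
  have := hPBC C A (LCauset.mem_stems.2 hA) B (LCauset.mem_stems.2 hB)
  rwa [hS _ h, hS _ h, LCauset.relabel_self] at this

lemma ProductBellCausality.of_range_subset (hPBC : P.ProductBellCausality) {n m : ℕ}
    {C : LCauset n} {A : Finset ℕ} (hA : C.IsStem A) (hmA : Finset.range m ⊆ A) :
    P.prob C A * P.prob (C.restrict A) (Finset.range m) =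
      P.prob (C.restrict A) (Finset.range A.card) * P.prob C (Finset.range m) := by
  have hm : m ≤ n := Finset.range_subset_range.1 (hmA.trans hA.1)
  have := hPBC.of_subset hA (C.isStem_range hm) hmA
  rwa [LCauset.relabel_range hmA] at this

lemma ProductBellCausality.of_subset_range (hPBC : P.ProductBellCausality) {n m : ℕ}
    {C : LCauset n} {A : Finset ℕ} (hm : m ≤ n) (hA : C.IsStem A) (hAm : A ⊆ Finset.range m) :
    P.prob C (Finset.range m) * P.prob (C.initial m) A =
      P.prob (C.initial m) (Finset.range m) * P.prob C A := by
  have := hPBC.of_subset (C.isStem_range hm) hA hAm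
  rwa [LCauset.relabel_of_subset_range hAm,
    P.prob_congr (Finset.card_range m) (C.restrict_range_rel m),
    P.prob_congr (Finset.card_range m) (C.restrict_range_rel m), Finset.card_range] at this

end Growth

/-! ### Relative gregarious transitions, era boundaries and breaks -/

namespace Growth

variable {P : Growth}

variable (P) in
lemma qRel_eq {m : ℕ} (a : LCauset m) (k : ℕ) :
    P.qRel a k = P.prob (a.addAbove m k le_rfl) (Finset.range m) := by
  rw [qRel, LCauset.stack_antichain]

variable (P) in
lemma qRel_zero {m : ℕ} (a : LCauset m) : P.qRel a 0 = P.prob a (Finset.range m) := by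
  rw [qRel_eq, LCauset.addAbove_zero]

variable (P) in
-- Lets the first era be treated as the era relative to the empty stack.
lemma qRel_antichain_zero (k : ℕ) : P.qRel (LCauset.antichain 0) k = P.q k := by
  rw [qRel_eq, q, Finset.range_zero]
  refine P.prob_congr (Nat.zero_add k) ?_ _
  funext i j
  simp [LCauset.addAbove, LCauset.antichain]

/-- The element with ancestor set `A` and the `j` elements above the first `m` are mutually
unrelated, so the order of their births is immaterial. -/
lemma GeneralCovariance.Prob_addAbove_grow (hGC : P.GeneralCovariance) {n m : ℕ} (C : LCauset n)
    {A : Finset ℕ} (hA : C.IsStem A) (hmA : Finset.range m ⊆ A) (j : ℕ) (hm : m ≤ n) :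
    P.Prob ((C.grow A hA).addAbove m j (hm.trans (Nat.le_succ n))) =
      P.Prob ((C.addAbove m j hm).grow A (hA.addAbove hmA)) := by
  have hA' : ∀ i ∈ A, i < n := fun i hi => Finset.mem_range.1 (hA.1 hi)
  have hmA' : ∀ i < m, i ∈ A := fun i hi => hmA (Finset.mem_range.2 hi)
  -- The label `n` moves to the end, and the `j` labels after it shift down by one.
  refine hGC.Prob_congr (by omega) _ _ (fun i => if i < n then i else if i = n then n + j else i - 1)
    (fun i hi => ?_) (fun i hi k hk hik => ?_) (fun i hi k hk => ?_)
  · split_ifs <;> omega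
  · split_ifs at hik <;> omega
  · have h1 := @C.lt_of_rel i k
    have h2 := @C.lt_card i k
    have h3 := hA' i
    simp only [LCauset.addAbove, LCauset.grow]
    by_cases hin : i < n
    · by_cases hkn : k < n
      · simp only [hin, hkn, if_true]
        have e1 : k ≠ n := by omega
        have e2 : k ≠ n + j := by omega
        have e3 : ¬ n + 1 ≤ k := by omega
        have e4 : ¬ n ≤ k := by omega
        simp only [e1, e2, e3, e4, and_false, false_and, or_false]
      · have e0 : ¬ C.rel i k := fun h => hkn (h2 h)
        by_cases hk' : k = n
        · subst hk'
          have e1 : ¬ C.rel i (k + j) := fun h => by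
            have := C.lt_card h
            omega
          simp [hin, e0, e1]
        · have e1 : ¬ C.rel i (k - 1) := fun h => by
            have := C.lt_card h
            omega
          have e2 : k - 1 ≠ n + j := by omega
          simp only [hin, hkn, hk', e0, e1, e2, if_true, if_false, and_false, false_or, or_false]
          omega
    · have hno : ∀ x y, n ≤ x → ¬ C.rel x y := fun x y hx h => by
        have := C.lt_card h
        have := C.lt_of_rel h
        omega
      have e0 : ¬ C.rel i k := hno i k (by omega)
      have e1 : i ∉ A := fun h => hin (hA' i h)
      by_cases hi' : i = n
      · subst hi'
        have e2 : i + j ∉ A := fun h => by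
          have := hA' _ h
          omega
        have e3 := hno (i + j) (if k < i then k else if k = i then i + j else k - 1) (by omega)
        simp only [lt_irrefl, if_false, if_true, e0, e1, e2, e3, false_and, or_false, false_or]
        omega
      · have e2 : i - 1 ∉ A := fun h => by
          have := hA' _ h
          omega
        have e3 := hno (i - 1) (if k < n then k else if k = n then n + j else k - 1) (by omega)
        simp only [hin, hi', if_false, e0, e1, e2, e3, false_and, or_false, false_or]
        omega

/-- The relative gregarious transition, for a causal set with `j` additional elements that lie
directly above the break. -/
lemma Prob_addAbove_ne_zero_and_prob_eq_qRel (hGC : P.GeneralCovariance)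
    (hPBC : P.ProductBellCausality) {m : ℕ} (a : LCauset m) :
    ∀ (r N : ℕ), N = m + r → ∀ (hm : m ≤ N) (D : LCauset N), D.HasBreak a → P.Prob D ≠ 0 →
      ∀ j, (∀ i < r + j, P.qRel a i ≠ 0) → P.Prob (D.addAbove m j hm) ≠ 0 ∧
        P.prob (D.addAbove m j hm) (Finset.range m) = P.qRel a (r + j) := by
  intro r
  -- The parameter `j` must stay general: the step for `D` with `j` extra elements uses the smaller
  -- `D₀` with both `j` and `j + 1`.
  induction r using Nat.strong_induction_on with
  | _ r ih =>
  cases r with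
  | zero =>
    rintro N rfl hm D hD hP j hj
    obtain rfl : D = a := by
      rw [← hD.2.1]
      exact (LCauset.initial_self D).symm
    simp only [Nat.zero_add] at hj ⊢
    refine ⟨?_, (P.qRel_eq D j).symm⟩
    induction j with
    | zero => rwa [LCauset.addAbove_zero]
    | succ j ihj =>
      rw [Prob_addAbove_succ]
      refine mul_ne_zero (ihj fun i hi => hj i (by omega)) ?_
      have := hj j (by omega)
      rwa [qRel_eq] at this
  | succ r =>
    rintro N rfl hm D hD hP j hj
    have hmr : m ≤ m + r := Nat.le_add_right _ _
    set D₀ : LCauset (m + r) := D.initial (m + r) with hD₀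
    set A := D.ancestors (m + r) with hA
    have hstem : D₀.IsStem A := D.isStem_ancestors
    have hmA : Finset.range m ⊆ A := hD.range_subset_ancestors hmr (Nat.lt_succ_self _)
    have hbreak : D₀.HasBreak a := hD.initial hmr (Nat.le_succ _)
    have hDeq : D = D₀.grow A hstem := D.grow_initial_ancestors.symm
    have hP₀ : P.Prob D₀ ≠ 0 := Prob_initial_ne_zero hP (Nat.le_succ _)
    have hv₀ : P.prob D₀ A ≠ 0 := prob_ancestors_ne_zero hP (Nat.lt_succ_self _)
    have hc : m ≤ A.card := by simpa using Finset.card_le_card hmA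
    have hc' : A.card ≤ m + r := by simpa using Finset.card_le_card hstem.1
    -- `D₀` restricted to `A` has at most `r` elements above `a`, so the induction hypothesis with
    -- no added elements gives its relative gregarious probability.
    have hs := ih (A.card - m) (by omega) A.card (by omega) hc (D₀.restrict A)
      (hbreak.restrict hmA hstem.1) (hGC.Prob_restrict_ne_zero hP₀ hstem) 0
      (fun i hi => hj i (by omega))
    simp only [LCauset.addAbove_zero, Nat.add_zero] at hs
    have hqs : P.qRel a (A.card - m) ≠ 0 := hj _ (by omega)
    -- Bell Causality for `A` against `Finset.range m`. The timid factor on the right does not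
    -- involve `l`; since `D` is possible, the case `l = 0` shows it is non-zero.
    have key : ∀ l, P.prob (D₀.addAbove m l hmr) A * P.qRel a (A.card - m) =
        P.prob (D₀.restrict A) (Finset.range A.card) *
          P.prob (D₀.addAbove m l hmr) (Finset.range m) := by
      intro l
      have := hPBC.of_range_subset (hstem.addAbove (j := l) (hm := hmr) hmA) hmA
      rwa [LCauset.restrict_addAbove _ _ hstem.1, hs.2] at this
    have hτ : P.prob (D₀.restrict A) (Finset.range A.card) ≠ 0 := by
      have := key 0
      rw [LCauset.addAbove_zero] at this
      intro h0
      rw [h0, zero_mul] at this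
      exact (mul_ne_zero hv₀ hqs) this
    have hu₀ := ih r (Nat.lt_succ_self r) (m + r) rfl hmr D₀ hbreak hP₀ j
      (fun i hi => hj i (by omega))
    have hu₁ := ih r (Nat.lt_succ_self r) (m + r) rfl hmr D₀ hbreak hP₀ (j + 1)
      (fun i hi => hj i (by omega))
    have hv : P.prob (D₀.addAbove m j hmr) A ≠ 0 := by
      intro h0
      have := key j
      rw [h0, zero_mul, hu₀.2] at this
      exact mul_ne_zero hτ (hj _ (by omega)) this.symm
    have hW : ∀ l, P.Prob (D.addAbove m l hm) =
        P.Prob (D₀.addAbove m l hmr) * P.prob (D₀.addAbove m l hmr) A := by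
      intro l
      rw [← Prob_grow, ← hGC.Prob_addAbove_grow D₀ hstem hmA l hmr, ← hDeq]
      exact (hstem.addAbove hmA)
    refine ⟨by rw [hW]; exact mul_ne_zero hu₀.1 hv, ?_⟩
    have h1 := P.Prob_addAbove_succ D hm j
    rw [hW, hW, Prob_addAbove_succ] at h1
    have k0 := key j
    have k1 := key (j + 1)
    rw [hu₁.2] at k1
    have e : r + 1 + j = r + (j + 1) := by omega
    rw [e]
    set X := P.prob (D.addAbove m j hm) (Finset.range m)
    set w := P.Prob (D₀.addAbove m j hmr)
    set u := P.prob (D₀.addAbove m j hmr) (Finset.range m)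
    set v := P.prob (D₀.addAbove m j hmr) A
    set v' := P.prob (D₀.addAbove m (j + 1) hmr) A
    set τ := P.prob (D₀.restrict A) (Finset.range A.card)
    set s := P.qRel a (A.card - m)
    have hu : u ≠ 0 := by
      rw [hu₀.2]
      exact hj _ (by omega)
    -- The two orders of birth give w u v' = w v X. With v s = τ u and v' s = τ q_(r+j+1), this
    -- forces X = q_(r+j+1).
    have h2 : u * v' = v * X := mul_left_cancel₀ hu₀.1 (by linear_combination h1)
    exact mul_left_cancel₀ (mul_ne_zero hu hτ) (by linear_combination u * k1 - s * h2 - X * k0)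

/-- The `a`-relative gregarious transition has probability `q_{(a) n}`. -/
lemma prob_range_eq_qRel (hGC : P.GeneralCovariance) (hPBC : P.ProductBellCausality) {m N : ℕ}
    {a : LCauset m} {C : LCauset N} (hC : C.HasBreak a) (hP : P.Prob C ≠ 0)
    (hq : ∀ i < N - m, P.qRel a i ≠ 0) : P.prob C (Finset.range m) = P.qRel a (N - m) := by
  have hm := hC.1
  have := (Prob_addAbove_ne_zero_and_prob_eq_qRel hGC hPBC a (N - m) N (by omega) hm C hC hP 0
    hq).2
  rwa [LCauset.addAbove_zero] at this

/-- Bell Causality against the relative gregarious transition, whose probabilities in `C` and in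
`C.restrict A` are both known. Only a timid probability remains to be found. -/
lemma prob_mul_qRel (hGC : P.GeneralCovariance) (hPBC : P.ProductBellCausality) {m N : ℕ}
    {a : LCauset m} {C : LCauset N} (hC : C.HasBreak a) (hP : P.Prob C ≠ 0)
    (hq : ∀ i < N - m, P.qRel a i ≠ 0) {A : Finset ℕ} (hA : C.IsStem A)
    (hmA : Finset.range m ⊆ A) :
    P.prob C A * P.qRel a (A.card - m) =
      P.prob (C.restrict A) (Finset.range A.card) * P.qRel a (N - m) := by
  have hc : A.card ≤ N := by simpa using Finset.card_le_card hA.1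
  have := hPBC.of_range_subset hA hmA
  rwa [prob_range_eq_qRel hGC hPBC hC hP hq, prob_range_eq_qRel hGC hPBC (hC.restrict hmA hA.1)
    (hGC.Prob_restrict_ne_zero hP hA) (fun i hi => hq i (by omega))] at this

variable (P) in
lemma prob_range_eq_one {n : ℕ} {C : LCauset n}
    (h : ∀ A, C.IsStem A → A ≠ Finset.range n → P.prob C A = 0) :
    P.prob C (Finset.range n) = 1 := by
  rw [← P.sum_prob C]
  refine (Finset.sum_eq_single _ (fun A hA hne => h A (LCauset.mem_stems.1 hA) hne) ?_).symm
  exact fun h => absurd (LCauset.mem_stems.2 (C.isStem_range le_rfl)) h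

/-- A proper stem containing `a` has fewer elements above the break, so its q is non-zero and
`prob_mul_qRel` applies. A stem inside `a` is compared with `Finset.range m`, and q_(a)0 ≠ 0 is
cancelled. -/
lemma prob_eq_zero_of_qRel_eq_zero (hGC : P.GeneralCovariance) (hPBC : P.ProductBellCausality)
    {m N : ℕ} {a : LCauset m} {C : LCauset N} (hmN : m < N) (hC : C.HasBreak a)
    (hP : P.Prob C ≠ 0) (hq : ∀ i < N - m, P.qRel a i ≠ 0) (hq' : P.qRel a (N - m) = 0)
    {A : Finset ℕ} (hA : C.IsStem A) (hne : A ≠ Finset.range N) : P.prob C A = 0 := by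
  by_cases hmA : Finset.range m ⊆ A
  · have h := prob_mul_qRel hGC hPBC hC hP hq hA hmA
    have hc : A.card < N := by
      have := Finset.card_lt_card (hA.1.ssubset_of_ne hne)
      rwa [Finset.card_range] at this
    rw [hq', mul_zero] at h
    exact (mul_eq_zero.1 h).resolve_right (hq _ (by omega))
  · have h := hPBC.of_subset_range hC.1 hA (hA.subset_range_of_hasBreak hC hmA)
    rw [prob_range_eq_qRel hGC hPBC hC hP hq, hq', zero_mul, hC.2.1, ← qRel_zero] at h
    exact (mul_eq_zero.1 h.symm).resolve_left (hq 0 (by omega))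

/-- If only the timid transition from `a` is possible, then after a break with past `a` every new
element is born above all of `a`. -/
lemma prob_eq_zero_of_not_range_subset (hPBC : P.ProductBellCausality) {m N : ℕ} {a : LCauset m}
    (ha : ∀ A, a.IsStem A → A ≠ Finset.range m → P.prob a A = 0) {C : LCauset N}
    (hC : C.HasBreak a) {A : Finset ℕ} (hA : C.IsStem A) (hmA : ¬ Finset.range m ⊆ A) :
    P.prob C A = 0 := by
  have hAm := hA.subset_range_of_hasBreak hC hmA
  have h := hPBC.of_subset_range hC.1 hA hAm
  have hAa : a.IsStem A := by
    refine ⟨hAm, fun i j hij hj => hA.2 i j ?_ hj⟩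
    rw [← hC.2.1] at hij
    exact hij.1
  rw [hC.2.1, ha A hAa (fun h => hmA h.ge), mul_zero, P.prob_range_eq_one ha, one_mul] at h
  exact h.symm

/-- If only the timid transition from `c(n)` is possible, then `c` has a break at rank `n`. -/
lemma Admits.hasBreak_initial (hPBC : P.ProductBellCausality) {c : InfCauset} (hc : P.Admits c)
    {n : ℕ} (h : ∀ A, (c.initial n).IsStem A → A ≠ Finset.range n → P.prob (c.initial n) A = 0) :
    c.HasBreak (c.initial n) := by
  refine ⟨rfl, ?_⟩
  have key : ∀ j, n ≤ j → ∀ i, i < n → c.rel i j := by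
    intro j
    induction j using Nat.strong_induction_on with
    | _ j ih =>
    intro hj
    have hinit : ∀ k, k ≤ j + 1 → (c.initial (j + 1)).initial k = c.initial k := by
      intro k hk
      refine LCauset.ext_rel fun x y => ?_
      exact ⟨fun h => ⟨h.1.1, h.2⟩, fun h => ⟨⟨h.1, by have := h.2; omega⟩, h.2⟩⟩
    have hbreak : (c.initial j).HasBreak (c.initial n) := by
      refine ⟨hj, ?_, fun i l hi hl hlj => ⟨ih l hlj hl i hi, hlj⟩⟩
      refine LCauset.ext_rel fun x y => ?_
      exact ⟨fun h => ⟨h.1.1, h.2⟩, fun h => ⟨⟨h.1, by have := h.2; omega⟩, h.2⟩⟩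
    -- By induction `c.initial j` already has the break, so a birth of non-zero probability at stage
    -- `j` must include all of the first `n` elements.
    have hne := prob_ancestors_ne_zero (hc (j + 1)) (Nat.lt_succ_self j)
    have hst := (c.initial (j + 1)).isStem_ancestors (k := j)
    rw [hinit j (Nat.le_succ j)] at hne hst
    intro i hi
    by_contra hij
    refine hne (prob_eq_zero_of_not_range_subset hPBC h hbreak hst fun hsub => hij ?_)
    exact (LCauset.mem_ancestors.1 (hsub (Finset.mem_range.2 hi))).1
  exact fun i j hi hj => key j hj i hi

end Growth

/-! ### Subset counts behind the normalisation of percolation -/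

/-- A set between `M` and `X` is `M` together with a subset of `X \ M`; grouping by cardinality
produces the binomial coefficients. -/
lemma sum_Icc_card_eq_gpLambda (t : ℕ → ℝ) {M X : Finset ℕ} (h : M ⊆ X) :
    ∑ S ∈ Finset.Icc M X, t S.card = gpLambda t X.card M.card := by
  have hc := Finset.card_le_card h
  have hdisj : ∀ U ∈ (X \ M).powerset, Disjoint M U := fun U hU =>
    Finset.disjoint_of_subset_right (Finset.mem_powerset.1 hU) Finset.disjoint_sdiff
  rw [Finset.Icc_eq_image_powerset h, Finset.sum_image]
  · rw [Finset.sum_congr rfl fun U hU => by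
        rw [Finset.card_union_of_disjoint (hdisj U hU)],
      Finset.sum_powerset_apply_card (fun j => t (M.card + j)), Finset.card_sdiff_of_subset h,
      gpLambda]
    refine Finset.sum_nbij' (fun i => M.card + i) (fun i => i - M.card) ?_ ?_ ?_ ?_ ?_
    · intro i hi
      simp only [Finset.mem_range, Finset.mem_Icc] at *
      omega
    · intro i hi
      simp only [Finset.mem_range, Finset.mem_Icc] at *
      omega
    · intro i _
      omega
    · intro i hi
      simp only [Finset.mem_Icc] at *
      omega
    · intro i hi
      rw [Finset.mem_range] at hi
      rw [nsmul_eq_mul, ← Nat.choose_symm (show i ≤ X.card - M.card by omega), Nat.sub_sub]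
  · intro U hU V hV hUV
    have h1 := hdisj U (Finset.mem_coe.1 hU)
    have h2 := hdisj V (Finset.mem_coe.1 hV)
    have e : ∀ W, Disjoint M W → (M ∪ W) \ M = W := fun W hW => by
      rw [Finset.union_sdiff_left, Finset.sdiff_eq_self_of_disjoint hW.symm]
    rw [← e U h1, ← e V h2]
    exact congrArg (· \ M) hUV

namespace LCauset

variable {n : ℕ}

lemma numAncestorsAbove_eq (C : LCauset n) {m : ℕ} {A : Finset ℕ} (h : Finset.range m ⊆ A) :
    C.numAncestorsAbove m A = A.card - m := by
  have e : A.filter (fun i => m ≤ i) = A \ Finset.range m := by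
    ext i
    simp
  rw [numAncestorsAbove, e, Finset.card_sdiff_of_subset h, Finset.card_range]

lemma numParentsAbove_restrict (C : LCauset n) {m : ℕ} {A : Finset ℕ}
    (h : Finset.range m ⊆ A) :
    (C.restrict A).numParentsAbove m (Finset.range A.card) = C.numParentsAbove m A := by
  classical
  refine Finset.card_nbij (Nat.nth (· ∈ A)) ?_ ?_ ?_
  · intro i hi
    simp only [Finset.coe_filter, Finset.mem_range, Set.mem_ofPred_eq] at hi ⊢
    refine ⟨Nat.nth_mem_finset hi.1, hi.2.1.trans (Nat.le_nth_finset hi.1), fun y hy hr => ?_⟩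
    obtain ⟨j, hj, rfl⟩ := Nat.exists_nth_finset_eq hy
    exact hi.2.2 j hj ⟨(Nat.nth_finset_lt_iff hi.1 hj).1 (C.lt_of_rel hr), hj, hr⟩
  · intro i hi j hj hij
    simp only [Finset.coe_filter, Finset.mem_range, Set.mem_ofPred_eq] at hi hj
    exact Nat.nth_finset_inj hi.1 hj.1 hij
  · intro x hx
    simp only [Finset.coe_filter, Set.mem_ofPred_eq] at hx
    obtain ⟨i, hi, rfl⟩ := Nat.exists_nth_finset_eq hx.1
    refine ⟨i, ?_, rfl⟩
    simp only [Finset.coe_filter, Finset.mem_range, Set.mem_ofPred_eq]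
    refine ⟨hi, ?_, fun j hj hr => hx.2.2 _ (Nat.nth_mem_finset hj) hr.2.2⟩
    by_contra hm
    rw [Nat.nth_finset_of_range_subset h (by omega)] at hx
    exact hm hx.2.1

lemma exists_maximal_ge (C : LCauset n) (X : Finset ℕ) {x : ℕ} (hx : x ∈ X) :
    ∃ y ∈ X, (∀ j ∈ X, ¬ C.rel y j) ∧ (x = y ∨ C.rel x y) := by
  classical
  have hne : (X.filter fun y => x = y ∨ C.rel x y).Nonempty := ⟨x, by simp [hx]⟩
  obtain ⟨y, hy, hmax⟩ := Finset.exists_max_image _ id hne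
  rw [Finset.mem_filter] at hy
  -- The candidate with the largest label is maximal, because the labelling is natural.
  refine ⟨y, hy.1, fun j hj hr => ?_, hy.2⟩
  have hxj : C.rel x j := by
    rcases hy.2 with rfl | h
    · exact hr
    · exact C.trans h hr
  have h1 := hmax j (Finset.mem_filter.2 ⟨hj, Or.inr hxj⟩)
  have h2 := C.lt_of_rel hr
  simp only [id] at h1
  omega

/-- Each set of elements above the first `m` generates a stem; summing over the stems first gives
the normalisation of generalised percolation. -/
lemma sum_gpLambda_stems (C : LCauset n) {m : ℕ} (hm : m ≤ n) (t : ℕ → ℝ) :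
    ∑ X ∈ C.stems.filter (Finset.range m ⊆ ·),
      gpLambda t (C.numAncestorsAbove m X) (C.numParentsAbove m X) =
    ∑ i ∈ Finset.range (n - m + 1), ((n - m).choose i : ℝ) * t i := by
  classical
  set E := Finset.range n \ Finset.range m with hE
  have hEc : E.card = n - m := by
    rw [hE, Finset.card_sdiff_of_subset (Finset.range_subset_range.2 hm), Finset.card_range,
      Finset.card_range]
  set gen : Finset ℕ → Finset ℕ := fun S =>
    (Finset.range n).filter (fun i => i < m ∨ i ∈ S ∨ ∃ j ∈ S, C.rel i j) with hgen
  have hmem : ∀ S ∈ E.powerset, ∀ i, i ∈ gen S ↔ (i < m ∨ i ∈ S ∨ ∃ j ∈ S, C.rel i j) := by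
    intro S hS i
    rw [Finset.mem_powerset] at hS
    simp only [hgen, Finset.mem_filter, Finset.mem_range, and_iff_right_iff_imp]
    rintro (h | h | ⟨j, _, h⟩)
    · omega
    · exact Finset.mem_range.1 (Finset.mem_sdiff.1 (hS h)).1
    · exact (C.lt_of_rel h).trans (C.lt_card h)
  have hmaps : ∀ S ∈ E.powerset, gen S ∈ C.stems.filter (Finset.range m ⊆ ·) := by
    intro S hS
    rw [Finset.mem_filter, mem_stems]
    refine ⟨⟨Finset.filter_subset _ _, fun i j hij hj => ?_⟩, fun i hi => ?_⟩
    · rw [hmem S hS] at hj ⊢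
      rcases hj with h | h | ⟨k, hk, h⟩
      · exact Or.inl ((C.lt_of_rel hij).trans h)
      · exact Or.inr (Or.inr ⟨j, h, hij⟩)
      · exact Or.inr (Or.inr ⟨k, hk, C.trans hij h⟩)
    · rw [hmem S hS]
      exact Or.inl (Finset.mem_range.1 hi)
  have hR : ∑ i ∈ Finset.range (n - m + 1), ((n - m).choose i : ℝ) * t i =
      ∑ S ∈ E.powerset, t S.card := by
    rw [Finset.sum_powerset_apply_card, hEc]
    simp only [nsmul_eq_mul]
  rw [hR, ← Finset.sum_fiberwise_of_maps_to hmaps]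
  refine Finset.sum_congr rfl fun X hX => ?_
  rw [Finset.mem_filter, mem_stems] at hX
  obtain ⟨hX, hmX⟩ := hX
  set Y := X.filter (fun i => m ≤ i) with hY
  set M := X.filter (fun i => m ≤ i ∧ ∀ j ∈ X, ¬ C.rel i j) with hM
  have hMY : M ⊆ Y := by
    intro i hi
    rw [hM, Finset.mem_filter] at hi
    rw [hY, Finset.mem_filter]
    exact ⟨hi.1, hi.2.1⟩
  have hYE : Y ⊆ E := by
    intro i hi
    rw [hY, Finset.mem_filter] at hi
    rw [hE, Finset.mem_sdiff, Finset.mem_range (n := m), not_lt]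
    exact ⟨hX.1 hi.1, hi.2⟩
  -- A set generates `X` exactly when it contains the maximal elements of `X` above the break and
  -- stays within the part of `X` above the break.
  have hfib : E.powerset.filter (fun S => gen S = X) = Finset.Icc M Y := by
    ext S
    rw [Finset.mem_filter, Finset.mem_Icc]
    constructor
    · rintro ⟨hS, rfl⟩
      refine ⟨fun i hi => ?_, fun i hi => ?_⟩
      · rw [hM, Finset.mem_filter] at hi
        rcases (hmem S hS i).1 hi.1 with h | h | ⟨j, hj, h⟩
        · omega
        · exact h
        · exact absurd h (hi.2.2 j ((hmem S hS j).2 (Or.inr (Or.inl hj))))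
      · rw [hY, Finset.mem_filter, hmem S hS]
        have := Finset.mem_powerset.1 hS hi
        rw [hE, Finset.mem_sdiff, Finset.mem_range (n := m), not_lt] at this
        exact ⟨Or.inr (Or.inl hi), this.2⟩
    · rintro ⟨hMS, hSY⟩
      have hS : S ∈ E.powerset := Finset.mem_powerset.2 (hSY.trans hYE)
      have hSX : S ⊆ X := hSY.trans (Finset.filter_subset _ _)
      refine ⟨hS, ?_⟩
      ext i
      rw [hmem S hS]
      constructor
      · rintro (h | h | ⟨j, hj, h⟩)
        · exact hmX (Finset.mem_range.2 h)
        · exact hSX h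
        · exact hX.2 i j h (hSX hj)
      · intro hi
        by_cases him : i < m
        · exact Or.inl him
        · obtain ⟨y, hy, hmax, hiy⟩ := C.exists_maximal_ge X hi
          have hyS : y ∈ S := by
            refine hMS ?_
            rw [hM, Finset.mem_filter]
            refine ⟨hy, ?_, hmax⟩
            rcases hiy with rfl | h
            · omega
            · have := C.lt_of_rel h
              omega
          rcases hiy with rfl | h
          · exact Or.inr (Or.inl hyS)
          · exact Or.inr (Or.inr ⟨y, hyS, h⟩)
  rw [hfib, sum_Icc_card_eq_gpLambda t hMY, numAncestorsAbove, numParentsAbove]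

end LCauset

/-! ### Transition probabilities within an era -/

namespace Growth

variable {P : Growth}

variable (P) in
/-- Binomial inversion of the definition of the coupling constants. -/
lemma sum_choose_mul_coupling {m : ℕ} (a : LCauset m) (k : ℕ) :
    ∑ i ∈ Finset.range (k + 1), (k.choose i : ℝ) * P.coupling m a i = (P.qRel a k)⁻¹ := by
  -- The coupling t_i is the i-th forward difference at 0 of k ↦ 1/q_(a)k, so this is Newton's
  -- expansion.
  have h := shift_eq_sum_fwdDiff_iter 1 (fun k => (P.qRel a k)⁻¹) k 0
  simp only [fwdDiff_iter_eq_sum_shift, smul_eq_mul, mul_one, zero_add, nsmul_eq_mul,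
    zsmul_eq_mul] at h
  rw [h]
  refine Finset.sum_congr rfl fun i _ => ?_
  rw [coupling]
  push_cast
  rfl

variable (P) in
lemma gpLambda_coupling_zero {m : ℕ} (a : LCauset m) (k : ℕ) :
    gpLambda (P.coupling m a) k 0 = (P.qRel a k)⁻¹ := by
  rw [← sum_choose_mul_coupling, gpLambda, Nat.range_succ_eq_Icc_zero]
  refine Finset.sum_congr rfl fun i hi => ?_
  rw [Nat.sub_zero, Nat.choose_symm (Finset.mem_Icc.1 hi).2]

variable (P) in
lemma coe_lt_eraLength_iff {m : ℕ} (a : LCauset m) (k : ℕ) :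
    (k : ℕ∞) < P.eraLength m a ↔ ∀ i ≤ k, P.qRel a i ≠ 0 := by
  constructor
  · intro h i hi h0
    have h1 : P.eraLength m a ≤ i := sInf_le ⟨i, rfl, h0⟩
    exact absurd (h.trans_le h1) (by exact_mod_cast not_lt.2 hi)
  · intro h
    have h1 : ((k + 1 : ℕ) : ℕ∞) ≤ P.eraLength m a := by
      refine le_sInf ?_
      rintro x ⟨i, rfl, h0⟩
      have : k < i := by
        by_contra hk
        exact h i (by omega) h0
      exact_mod_cast this
    exact lt_of_lt_of_le (by exact_mod_cast Nat.lt_succ_self k) h1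

lemma qRel_of_eraLength_eq {m k : ℕ} {a : LCauset m} (h : P.eraLength m a = k) :
    (∀ i < k, P.qRel a i ≠ 0) ∧ P.qRel a k = 0 := by
  have h1 : ∀ i < k, P.qRel a i ≠ 0 := fun i hi =>
    (P.coe_lt_eraLength_iff a i).1 (by rw [h]; exact_mod_cast hi) i le_rfl
  refine ⟨h1, ?_⟩
  by_contra h0
  have : (k : ℕ∞) < P.eraLength m a := by
    rw [coe_lt_eraLength_iff]
    intro i hi
    rcases hi.lt_or_eq with hi | rfl
    · exact h1 i hi
    · exact h0
  rw [h] at this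
  exact lt_irrefl _ this

/-- An admitted stack has non-zero probability, and only the timid transition from it is
possible. -/
lemma AdmittedStack.prob_eq_zero (hGC : P.GeneralCovariance) (hPBC : P.ProductBellCausality)
    {m : ℕ} {a : LCauset m} (ha : P.AdmittedStack P.eraLength a) :
    P.Prob a ≠ 0 ∧ ∀ A, a.IsStem A → A ≠ Finset.range m → P.prob a A = 0 := by
  induction ha with
  | empty =>
    refine ⟨by simp [Prob], fun A hA hne => absurd ?_ hne⟩
    rw [Finset.range_zero, ← Finset.subset_empty]
    exact hA.1
  | @next m k a c _ hlen hc hP ih =>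
    refine ⟨hP, fun A hA hne => ?_⟩
    obtain ⟨h1, h2⟩ := qRel_of_eraLength_eq hlen
    -- By induction only the timid transition leaves `a`, so q_(a)0 = 1 and the era cannot be empty.
    have hk : k ≠ 0 := by
      rintro rfl
      rw [qRel_zero, P.prob_range_eq_one ih.2] at h2
      exact one_ne_zero h2
    refine prob_eq_zero_of_qRel_eq_zero hGC hPBC (by omega) hc hP ?_ ?_ hA hne
    · rwa [Nat.add_sub_cancel_left]
    · rwa [Nat.add_sub_cancel_left]

/-- The timid transition probability in the era that follows `a`. -/
lemma prob_timid_eq (hGC : P.GeneralCovariance) (hPBC : P.ProductBellCausality)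
    {m : ℕ} {a : LCauset m} (ha : ∀ A, a.IsStem A → A ≠ Finset.range m → P.prob a A = 0) :
    ∀ (N : ℕ) (C : LCauset N), C.HasBreak a → P.Prob C ≠ 0 → (∀ i ≤ N - m, P.qRel a i ≠ 0) →
      P.prob C (Finset.range N) =
        gpLambda (P.coupling m a) (N - m) (C.numParentsAbove m (Finset.range N)) *
          P.qRel a (N - m) := by
  intro N
  induction N using Nat.strong_induction_on with
  | _ N ih =>
  intro C hC hP hq
  classical
  have hm := hC.1
  have hsum := P.sum_prob C
  rw [← Finset.sum_filter_add_sum_filter_not _ (Finset.range m ⊆ ·),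
    Finset.sum_eq_zero (s := C.stems.filter fun x => ¬ Finset.range m ⊆ x), add_zero] at hsum
  swap
  · intro A hA
    rw [Finset.mem_filter, LCauset.mem_stems] at hA
    exact prob_eq_zero_of_not_range_subset hPBC ha hC hA.1 hA.2
  have hmem : Finset.range N ∈ C.stems.filter (Finset.range m ⊆ ·) := by
    rw [Finset.mem_filter, LCauset.mem_stems]
    exact ⟨C.isStem_range le_rfl, Finset.range_subset_range.2 hm⟩
  have hlam := C.sum_gpLambda_stems hm (P.coupling m a)
  rw [sum_choose_mul_coupling, ← Finset.add_sum_erase _ _ hmem] at hlam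
  rw [← Finset.add_sum_erase _ _ hmem] at hsum
  -- A proper stem has a smaller restriction, whose timid probability is known by induction. Both
  -- normalisations then differ only in the full stem, which determines its probability.
  have hrest : ∑ X ∈ (C.stems.filter (Finset.range m ⊆ ·)).erase (Finset.range N), P.prob C X =
      (∑ X ∈ (C.stems.filter (Finset.range m ⊆ ·)).erase (Finset.range N),
        gpLambda (P.coupling m a) (C.numAncestorsAbove m X) (C.numParentsAbove m X)) *
          P.qRel a (N - m) := by
    rw [Finset.sum_mul]
    refine Finset.sum_congr rfl fun X hX => ?_
    rw [Finset.mem_erase, Finset.mem_filter, LCauset.mem_stems] at hX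
    obtain ⟨hne, hX, hmX⟩ := hX
    have hc : X.card < N := by
      have := Finset.card_lt_card (hX.1.ssubset_of_ne hne)
      rwa [Finset.card_range] at this
    have h1 := ih X.card hc (C.restrict X) (hC.restrict hmX hX.1)
      (hGC.Prob_restrict_ne_zero hP hX) (fun i hi => hq i (by omega))
    have h2 := prob_mul_qRel hGC hPBC hC hP (fun i hi => hq i hi.le) hX hmX
    rw [h1, LCauset.numParentsAbove_restrict C hmX] at h2
    rw [LCauset.numAncestorsAbove_eq C hmX]
    exact mul_right_cancel₀ (hq (X.card - m) (by omega)) (by linear_combination h2)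
  rw [hrest] at hsum
  rw [LCauset.numAncestorsAbove_eq C (Finset.range_subset_range.2 hm), Finset.card_range] at hlam
  have hinv := inv_mul_cancel₀ (hq (N - m) le_rfl)
  linear_combination hsum - P.qRel a (N - m) * hlam - hinv

/-- The transition probabilities in the era that follows `a`. -/
lemma prob_eq_gpLambda_div (hGC : P.GeneralCovariance) (hPBC : P.ProductBellCausality)
    {m N : ℕ} {a : LCauset m} (ha : ∀ A, a.IsStem A → A ≠ Finset.range m → P.prob a A = 0)
    {C : LCauset N} (hC : C.HasBreak a) (hP : P.Prob C ≠ 0)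
    (hq : ∀ i ≤ N - m, P.qRel a i ≠ 0) {A : Finset ℕ} (hA : C.IsStem A)
    (hmA : Finset.range m ⊆ A) :
    P.prob C A = gpLambda (P.coupling m a) (C.numAncestorsAbove m A) (C.numParentsAbove m A) /
      gpLambda (P.coupling m a) (N - m) 0 := by
  have hc : A.card ≤ N := by simpa using Finset.card_le_card hA.1
  have h1 := prob_timid_eq hGC hPBC ha A.card (C.restrict A) (hC.restrict hmA hA.1)
    (hGC.Prob_restrict_ne_zero hP hA) (fun i hi => hq i (by omega))
  have h2 := prob_mul_qRel hGC hPBC hC hP (fun i hi => hq i hi.le) hA hmA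
  rw [h1, LCauset.numParentsAbove_restrict C hmA] at h2
  rw [LCauset.numAncestorsAbove_eq C hmA, gpLambda_coupling_zero, div_inv_eq_mul]
  exact mul_right_cancel₀ (hq (A.card - m) (by omega)) (by linear_combination h2)

/-- For the timid transition from the `a`-relative `i`-antichain, ϖ = p = i and λ(i, i) = t_i. Its
probability is t_i · q_(a)i with q_(a)i > 0. -/
lemma coupling_nonneg (hGC : P.GeneralCovariance) (hPBC : P.ProductBellCausality)
    {m : ℕ} {a : LCauset m} (hP : P.Prob a ≠ 0)
    (ha : ∀ A, a.IsStem A → A ≠ Finset.range m → P.prob a A = 0) {i : ℕ}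
    (hq : ∀ l ≤ i, P.qRel a l ≠ 0) : 0 ≤ P.coupling m a i := by
  have hsub : m + i - m = i := Nat.add_sub_cancel_left _ _
  set C := a.addAbove m i le_rfl with hC
  have hbreak : C.HasBreak a := (LCauset.hasBreak_self a).addAbove i
  have hPC := (Prob_addAbove_ne_zero_and_prob_eq_qRel hGC hPBC a 0 m rfl le_rfl a
    (LCauset.hasBreak_self a) hP i (fun l hl => hq l (by omega))).1
  have hstem := C.isStem_range (m := m + i) le_rfl
  have h := prob_timid_eq hGC hPBC ha (m + i) C hbreak hPC (by rwa [hsub])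
  have hpar : C.numParentsAbove m (Finset.range (m + i)) = i := by
    classical
    have e : (Finset.range (m + i)).filter
        (fun x => m ≤ x ∧ ∀ j ∈ Finset.range (m + i), ¬ C.rel x j) =
        Finset.range (m + i) \ Finset.range m := by
      ext x
      simp only [Finset.mem_filter, Finset.mem_sdiff, Finset.mem_range, not_lt]
      refine and_congr_right fun _ => and_iff_left_of_imp fun hx j _ hr => ?_
      rcases hr with hr | hr
      · have := a.lt_of_rel hr
        have := a.lt_card hr
        omega
      · omega
    rw [LCauset.numParentsAbove, e, Finset.card_sdiff_of_subset
      (Finset.range_subset_range.2 (Nat.le_add_right m i)), Finset.card_range, Finset.card_range,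
      hsub]
  have hlam : gpLambda (P.coupling m a) i i = P.coupling m a i := by
    simp [gpLambda]
  rw [hpar, hsub, hlam] at h
  have hpos : 0 < P.qRel a i := by
    refine lt_of_le_of_ne ?_ (hq i le_rfl).symm
    rw [qRel_eq]
    exact P.prob_nonneg _ _ (LCauset.mem_stems.2 (LCauset.isStem_range _ (by omega)))
  have hnn : 0 ≤ P.prob C (Finset.range (m + i)) :=
    P.prob_nonneg _ _ (LCauset.mem_stems.2 hstem)
  rw [h] at hnn
  exact nonneg_of_mul_nonneg_left hnn hpos

lemma GeneralCovariance.Prob_addAbove_iso (hGC : P.GeneralCovariance) {m : ℕ} {a a' : LCauset m}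
    (h : a.Iso a') (k : ℕ) :
    P.Prob (a.addAbove m k le_rfl) = P.Prob (a'.addAbove m k le_rfl) := by
  obtain ⟨σ, hσ⟩ := h
  set f : ℕ → ℕ := fun i => if h : i < m then σ ⟨i, h⟩ else i with hf
  have f1 : ∀ i (h : i < m), f i = σ ⟨i, h⟩ := fun i h => by simp [hf, h]
  have f2 : ∀ i, ¬ i < m → f i = i := fun i h => by simp [hf, h]
  have f3 : ∀ i, i < m ↔ f i < m := fun i => by
    by_cases h : i < m
    · rw [f1 i h]
      exact ⟨fun _ => (σ ⟨i, h⟩).2, fun _ => h⟩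
    · rw [f2 i h]
  refine hGC.Prob_congr rfl _ _ f (fun i hi => ?_) (fun i _ j _ hij => ?_) (fun i hi j hj => ?_)
  · by_cases h : i < m
    · have := (f3 i).1 h
      omega
    · rwa [f2 i h]
  · have h3 := f3 i
    rw [hij, ← f3 j] at h3
    by_cases h : i < m
    · rw [f1 i h, f1 j (h3.1 h)] at hij
      exact Fin.mk.inj (σ.injective (Fin.ext hij))
    · rwa [f2 i h, f2 j (fun h' => h (h3.2 h'))] at hij
  · have hr : a.rel i j ↔ a'.rel (f i) (f j) := by
      by_cases hj' : j < m
      · by_cases hi' : i < m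
        · rw [f1 i hi', f1 j hj']
          exact hσ ⟨i, hi'⟩ ⟨j, hj'⟩
        · have := f2 i hi'
          have := (f3 j).1 hj'
          refine iff_of_false (fun h => ?_) (fun h => ?_)
          · have := a.lt_of_rel h
            omega
          · have := a'.lt_of_rel h
            omega
      · have := f2 j hj'
        refine iff_of_false (fun h => ?_) (fun h => ?_)
        · have := a.lt_card h
          omega
        · have := a'.lt_card h
          omega
    simp only [LCauset.addAbove]
    refine or_congr hr (and_congr (f3 i) ?_)
    by_cases h : j < m
    · have := (f3 j).1 h
      omega
    · rw [f2 j h]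

/-- q_(a)k is the ratio of the probabilities of two successive relative antichains, and these are
covariant. The earlier q's must be non-zero for the denominator not to vanish. -/
lemma qRel_eq_of_iso (hGC : P.GeneralCovariance) (hPBC : P.ProductBellCausality)
    {m : ℕ} {a a' : LCauset m} (hP : P.Prob a ≠ 0) (h : a.Iso a') {k : ℕ}
    (hq : ∀ l < k, P.qRel a l ≠ 0) : P.qRel a k = P.qRel a' k := by
  have hne := (Prob_addAbove_ne_zero_and_prob_eq_qRel hGC hPBC a 0 m rfl le_rfl a
    (LCauset.hasBreak_self a) hP k (fun l hl => hq l (by omega))).1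
  have h1 := P.Prob_addAbove_succ a le_rfl k
  have h2 := P.Prob_addAbove_succ a' le_rfl k
  rw [← hGC.Prob_addAbove_iso h, ← hGC.Prob_addAbove_iso h, h1, ← qRel_eq, ← qRel_eq] at h2
  exact mul_left_cancel₀ hne h2

lemma eraLength_le_of_iso (hGC : P.GeneralCovariance) (hPBC : P.ProductBellCausality)
    {m : ℕ} {a a' : LCauset m} (hP : P.Prob a ≠ 0) (h : a.Iso a') :
    P.eraLength m a ≤ P.eraLength m a' := by
  refine le_sInf ?_
  rintro x ⟨k, rfl, h0⟩
  by_contra hk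
  rw [not_le, coe_lt_eraLength_iff] at hk
  refine hk k le_rfl ?_
  rw [qRel_eq_of_iso hGC hPBC hP h fun l hl => hk l hl.le, h0]

end Growth

lemma LCauset.Iso.symm {n : ℕ} {C C' : LCauset n} (h : C.Iso C') : C'.Iso C := by
  obtain ⟨σ, hσ⟩ := h
  refine ⟨σ.symm, fun i j => ?_⟩
  rw [hσ, σ.apply_symm_apply, σ.apply_symm_apply]

/-! ### Assembly of the theorem -/

namespace Growth

variable {P : Growth}

/-- The dynamics is the extended percolation with the era lengths and coupling constants read
off from the relative antichain transitions. -/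
lemma isExtendedPercolationWith (hGC : P.GeneralCovariance) (hPBC : P.ProductBellCausality) :
    P.IsExtendedPercolationWith P.eraLength P.coupling where
  one_le_len a ha := by
    have h : ((0 : ℕ) : ℕ∞) < P.eraLength _ a := by
      rw [coe_lt_eraLength_iff]
      intro i hi
      rw [Nat.le_zero.1 hi, qRel_zero, P.prob_range_eq_one (ha.prob_eq_zero hGC hPBC).2]
      exact one_ne_zero
    exact Order.one_le_iff_pos.2 (by exact_mod_cast h)
  coupling_zero a ha := by
    simp [coupling, qRel_zero, P.prob_range_eq_one (ha.prob_eq_zero hGC hPBC).2]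
  coupling_nonneg a ha i hi :=
    have h := ha.prob_eq_zero hGC hPBC
    coupling_nonneg hGC hPBC h.1 h.2 ((P.coe_lt_eraLength_iff a i).1 hi)
  len_iso a a' ha ha' h :=
    le_antisymm (eraLength_le_of_iso hGC hPBC (ha.prob_eq_zero hGC hPBC).1 h)
      (eraLength_le_of_iso hGC hPBC (ha'.prob_eq_zero hGC hPBC).1 h.symm)
  coupling_iso a a' ha ha' h i hi := by
    rw [coe_lt_eraLength_iff] at hi
    refine Finset.sum_congr rfl fun k hk => ?_
    rw [Finset.mem_range] at hk
    rw [qRel_eq_of_iso hGC hPBC (ha.prob_eq_zero hGC hPBC).1 h fun l hl => hi l (by omega)]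
  prob_of_superset {m k} a ha hk c hc hP A hA hmA := by
    rw [coe_lt_eraLength_iff] at hk
    have hsub : m + k - m = k := Nat.add_sub_cancel_left _ _
    have h := prob_eq_gpLambda_div hGC hPBC (ha.prob_eq_zero hGC hPBC).2 hc hP (by rwa [hsub])
      (LCauset.mem_stems.1 hA) hmA
    rwa [hsub] at h
  prob_of_not_superset a ha _ c hc _ A hA hmA :=
    prob_eq_zero_of_not_range_subset hPBC (ha.prob_eq_zero hGC hPBC).2 hc
      (LCauset.mem_stems.1 hA) hmA

lemma prob_ne_zero_iff_of_forall {n : ℕ} {C : LCauset n}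
    (h : ∀ A, C.IsStem A → A ≠ Finset.range n → P.prob C A = 0) {A : Finset ℕ}
    (hA : A ∈ C.stems) : P.prob C A ≠ 0 ↔ A = Finset.range n := by
  constructor
  · intro h0
    by_contra hne
    exact h0 (h A (LCauset.mem_stems.1 hA) hne)
  · rintro rfl
    rw [P.prob_range_eq_one h]
    exact one_ne_zero

variable (P) in
lemma q_zero : P.q 0 = 1 :=
  P.prob_range_eq_one fun _ hA hne => absurd (Finset.subset_empty.1 hA.1) hne

end Growth

lemma LCauset.hasBreak_antichain_zero {n : ℕ} (C : LCauset n) :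
    C.HasBreak (LCauset.antichain 0) := by
  refine ⟨Nat.zero_le n, ?_, fun i _ hi => absurd hi (Nat.not_lt_zero i)⟩
  exact LCauset.ext_rel fun i j => ⟨fun h => Nat.not_lt_zero _ h.2, False.elim⟩

theorem mainTheorem2 (P : Growth) (hGC : P.GeneralCovariance) (hPBC : P.ProductBellCausality) :
    -- gregarious transitions, first era
    (∀ (n : ℕ) (C : LCauset n), P.Prob C ≠ 0 → (∀ i < n, P.q i ≠ 0) →
      P.prob C ∅ = P.q n) ∧
    -- gregarious transitions relative to `a`
    (∀ (m n : ℕ) (a : LCauset m) (C : LCauset (m + n)), C.HasBreak a → P.Prob C ≠ 0 →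
      (∀ i < n, P.qRel a i ≠ 0) → P.prob C (Finset.range m) = P.qRel a n) ∧
    -- only timid transitions at the first vanishing antichain transition
    (∀ n : ℕ, (∀ l < n, P.q l ≠ 0) → P.q n = 0 →
      ∀ C : LCauset n, P.Prob C ≠ 0 → ∀ A ∈ C.stems, (P.prob C A ≠ 0 ↔ A = Finset.range n)) ∧
    -- the same relative to `a`
    (∀ (m n : ℕ) (a : LCauset m), 1 ≤ n → (∀ l < n, P.qRel a l ≠ 0) → P.qRel a n = 0 →
      ∀ C : LCauset (m + n), C.HasBreak a → P.Prob C ≠ 0 →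
        ∀ A ∈ C.stems, (P.prob C A ≠ 0 ↔ A = Finset.range (m + n))) ∧
    -- admitted causal sets have a break there
    (∀ n : ℕ, (∀ l < n, P.q l ≠ 0) → P.q n = 0 →
      ∀ c : InfCauset, P.Admits c → c.HasBreak (c.initial n)) ∧
    -- the same relative to `a`
    (∀ (m n : ℕ) (a : LCauset m), 1 ≤ n → (∀ l < n, P.qRel a l ≠ 0) → P.qRel a n = 0 →
      ∀ c : InfCauset, P.Admits c → c.HasBreak a → c.HasBreak (c.initial (m + n))) ∧
    -- the dynamics is extended percolation
    P.IsExtendedPercolationWith P.eraLength P.coupling := by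
  have timid : ∀ (m n : ℕ) (a : LCauset m), 1 ≤ n → (∀ l < n, P.qRel a l ≠ 0) →
      P.qRel a n = 0 → ∀ C : LCauset (m + n), C.HasBreak a → P.Prob C ≠ 0 →
      ∀ A, C.IsStem A → A ≠ Finset.range (m + n) → P.prob C A = 0 := by
    intro m n a hn hq hq' C hC hP A hA hne
    refine Growth.prob_eq_zero_of_qRel_eq_zero hGC hPBC (by omega) hC hP ?_ ?_ hA hne
    · rwa [Nat.add_sub_cancel_left]
    · rwa [Nat.add_sub_cancel_left]
  have timid₀ : ∀ n : ℕ, (∀ l < n, P.q l ≠ 0) → P.q n = 0 → ∀ C : LCauset n, P.Prob C ≠ 0 →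
      ∀ A, C.IsStem A → A ≠ Finset.range n → P.prob C A = 0 := by
    intro n hq hq' C hP A hA hne
    -- The empty causal set has a single transition, so q_0 = 1 and `n ≥ 1` is automatic here;
    -- relative to an arbitrary `a` it has to be assumed.
    have hn : n ≠ 0 := by
      rintro rfl
      rw [P.q_zero] at hq'
      exact one_ne_zero hq'
    refine Growth.prob_eq_zero_of_qRel_eq_zero hGC hPBC (Nat.pos_of_ne_zero hn)
      C.hasBreak_antichain_zero hP (fun i hi => ?_) ?_ hA hne
    · rw [P.qRel_antichain_zero]
      exact hq i hi
    · rwa [P.qRel_antichain_zero]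
  refine ⟨fun n C hP hq => ?_, fun m n a C hC hP hq => ?_, fun n hq hq' C hP A hA => ?_,
    fun m n a hn hq hq' C hC hP A hA => ?_, fun n hq hq' c hc => ?_,
    fun m n a hn hq hq' c hc hca => ?_, Growth.isExtendedPercolationWith hGC hPBC⟩
  · have h := Growth.prob_range_eq_qRel hGC hPBC C.hasBreak_antichain_zero hP
      (fun i hi => by rw [P.qRel_antichain_zero]; exact hq i hi)
    rwa [P.qRel_antichain_zero] at h
  · have h := Growth.prob_range_eq_qRel hGC hPBC hC hP (by rwa [Nat.add_sub_cancel_left])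
    rwa [Nat.add_sub_cancel_left] at h
  · exact Growth.prob_ne_zero_iff_of_forall (timid₀ n hq hq' C hP) hA
  · exact Growth.prob_ne_zero_iff_of_forall (timid m n a hn hq hq' C hC hP) hA
  · exact hc.hasBreak_initial hPBC (timid₀ n hq hq' _ (hc n))
  · refine hc.hasBreak_initial hPBC (timid m n a hn hq hq' _ ?_ (hc _))
    refine ⟨Nat.le_add_right m n, ?_, fun i j hi hj hjn => ⟨hca.2 i j hi hj, hjn⟩⟩
    rw [← hca.1]
    exact LCauset.ext_rel fun i j =>
      ⟨fun h => ⟨h.1.1, h.2⟩, fun h => ⟨⟨h.1, by have := h.2; omega⟩, h.2⟩⟩
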